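/- Let $\mathcal H$ be a real or complex Hilbert space and let $E$ be a (not necessarily bounded) symmetric linear operator defined on a dense linear subspace $\mathcal D\subset\mathcal H$, i.e. $\langle Ef,g\rangle=\langle f,Eg\rangle$ for all $f,g\in\mathcal D$. Let $\{d_i\}_{i\in\mathbb N}$ and $\{\lambda_i\}_{i\in\mathbb N}$ be two nondecreasing unbounded sequences of real numbers such that $$\sum_{i=1}^{n}\lambda_i\le\sum_{i=1}^{n}d_i\qquad\text{for all } n\in\mathbb N.$$ If $\{f_i\}_{i\in\mathbb N}\subset\mathcal D$ is an orthonormal sequence such that $\langle Ef_i,f_i\rangle=\lambda_i$ for all $i\in\mathbb N$, then there exists an orthonormal sequence $\{e_i\}_{i\in\mathbb N}\subset\operatorname{span}\{f_i\}_{i\in\mathbb N}$ (finite linear combinations) such that $\overline{\operatorname{span}}\{e_i\}_{i\in\mathbb N}=\overline{\operatorname{span}}\{f_i\}_{i\in\mathbb N}$ and $\langle Ee_i,e_i\rangle=d_i$ for all $i\in\mathbb N$. -/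

import Mathlib

open scoped InnerProductSpace

/-!
Write `q v = re ⟪E v, v⟫`.  Rotating two orthonormal vectors `v`, `w` inside their plane moves
an amount `t` of `q` from `w` to `v` without changing `q v + q w`; by the intermediate value
theorem every amount between `0` and `q w - q v` can be moved.

*Finite blocks.*  If `∑_{s ≤ i < n} (d i - q (g i))` is nonnegative for `s ≤ n ≤ m` and vanishes
for `n = m`, then finitely many rotations among `g s, …, g (m - 1)` give these vectors the
diagonal `d s, …, d (m - 1)` (`exists_rotation_block`): let `j` be the first index with
`d s ≤ q (g j)`, rotate `g s` with `g j` until `q (g s) = d s`, and proceed with `s + 1`.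

*Creating an exact block.*  For nonnegative deficits, choose `M` far out and let `t` be the least of
the sums `∑_{s ≤ i < n} (d i - q (g i))` with `s < n ≤ M`, attained at `n = m`.  Moving `t` from
`g M` to `g s` keeps all deficits nonnegative and makes the block `s, …, m - 1` exact.  Since
`q (g M)` is as large as desired while `⟪E (g s), g M⟫` stays bounded by `‖E (g s)‖`, the angle of
this rotation is at most `π / 6` (`IsStage.exists_refines`).

*Completeness.*  Repeating this yields the sequence `e`.  The vector `g s` lies in the span of `e`
up to `β • g' M` with `|β| ≤ 1 / 2`, and the later vector `g' M` is treated in the same manner at a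
later stage (`Refines.exists_norm_sub_le`).  Hence the distance of each `f i` to the span of `e` is at most
`(1 / 2) ^ r` for every `r`.
-/

section Construction

open Finset Filter

variable {𝕜 : Type*} [RCLike 𝕜] {H : Type*} [NormedAddCommGroup H] [InnerProductSpace 𝕜 H]

/-! ### Plane rotations of a sequence -/

section Rotation

variable {V : Type*} [NormedAddCommGroup V] [InnerProductSpace 𝕜 V]

/-- The sequence obtained from `g` by rotating the pair `(g i, g j)` by the angle `θ` in the real
plane that it spans; the other terms are unchanged. It is meant for `i ≠ j`. -/
noncomputable def rotatePair (𝕜 : Type*) [RCLike 𝕜] {V : Type*} [NormedAddCommGroup V]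
    [InnerProductSpace 𝕜 V] (g : ℕ → V) (i j : ℕ) (θ : ℝ) (k : ℕ) : V :=
  if k = i then ((Real.cos θ : ℝ) : 𝕜) • g i + ((Real.sin θ : ℝ) : 𝕜) • g j
  else if k = j then ((-Real.sin θ : ℝ) : 𝕜) • g i + ((Real.cos θ : ℝ) : 𝕜) • g j
  else g k

theorem rotatePair_left (g : ℕ → V) (i j : ℕ) (θ : ℝ) :
    rotatePair 𝕜 g i j θ i = ((Real.cos θ : ℝ) : 𝕜) • g i + ((Real.sin θ : ℝ) : 𝕜) • g j := by
  simp [rotatePair]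

theorem rotatePair_right (g : ℕ → V) {i j : ℕ} (hij : i ≠ j) (θ : ℝ) :
    rotatePair 𝕜 g i j θ j = ((-Real.sin θ : ℝ) : 𝕜) • g i + ((Real.cos θ : ℝ) : 𝕜) • g j := by
  simp [rotatePair, hij.symm]

theorem rotatePair_of_ne (g : ℕ → V) {i j k : ℕ} (hi : k ≠ i) (hj : k ≠ j) (θ : ℝ) :
    rotatePair 𝕜 g i j θ k = g k := by
  simp [rotatePair, hi, hj]

theorem cos_sq_add_sin_sq_coe (θ : ℝ) :
    ((Real.cos θ : ℝ) : 𝕜) * ((Real.cos θ : ℝ) : 𝕜) +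
      ((Real.sin θ : ℝ) : 𝕜) * ((Real.sin θ : ℝ) : 𝕜) = 1 := by
  have h : Real.cos θ * Real.cos θ + Real.sin θ * Real.sin θ = 1 := by
    nlinarith [Real.sin_sq_add_cos_sq θ]
  exact_mod_cast congrArg (fun x : ℝ => (x : 𝕜)) h

theorem left_eq_rotatePair (g : ℕ → V) {i j : ℕ} (hij : i ≠ j) (θ : ℝ) :
    g i = ((Real.cos θ : ℝ) : 𝕜) • rotatePair 𝕜 g i j θ i +
      ((-Real.sin θ : ℝ) : 𝕜) • rotatePair 𝕜 g i j θ j := by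
  rw [rotatePair_left, rotatePair_right g hij]
  push_cast
  linear_combination (norm := module) (-(cos_sq_add_sin_sq_coe (𝕜 := 𝕜) θ)) • (g i)

theorem right_eq_rotatePair (g : ℕ → V) {i j : ℕ} (hij : i ≠ j) (θ : ℝ) :
    g j = ((Real.sin θ : ℝ) : 𝕜) • rotatePair 𝕜 g i j θ i +
      ((Real.cos θ : ℝ) : 𝕜) • rotatePair 𝕜 g i j θ j := by
  rw [rotatePair_left, rotatePair_right g hij]
  push_cast
  linear_combination (norm := module) (-(cos_sq_add_sin_sq_coe (𝕜 := 𝕜) θ)) • (g j)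

theorem Orthonormal.rotatePair {g : ℕ → V} (hg : Orthonormal 𝕜 g) {i j : ℕ} (hij : i ≠ j)
    (θ : ℝ) : Orthonormal 𝕜 (rotatePair 𝕜 g i j θ) := by
  have h1 := cos_sq_add_sin_sq_coe (𝕜 := 𝕜) θ
  rw [orthonormal_iff_ite] at hg ⊢
  intro k l
  unfold _root_.rotatePair
  split_ifs <;>
    simp only [inner_add_left, inner_add_right, inner_smul_left, inner_smul_right,
      RCLike.conj_ofReal, map_neg, hg] <;>
    split_ifs <;>
    first
    | (exfalso; omega)
    | linear_combination h1
    | ring1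

theorem span_image_rotatePair (g : ℕ → V) {i j : ℕ} (hij : i ≠ j) (θ : ℝ) {S : Set ℕ}
    (hi : i ∈ S) (hj : j ∈ S) :
    Submodule.span 𝕜 (rotatePair 𝕜 g i j θ '' S) = Submodule.span 𝕜 (g '' S) := by
  apply le_antisymm <;> rw [Submodule.span_le] <;> rintro _ ⟨k, hk, rfl⟩ <;> rw [SetLike.mem_coe]
  · have hg : ∀ l ∈ S, g l ∈ Submodule.span 𝕜 (g '' S) := fun l hl =>
      Submodule.subset_span ⟨l, hl, rfl⟩
    unfold rotatePair
    split_ifs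
    · exact add_mem (Submodule.smul_mem _ _ (hg i hi)) (Submodule.smul_mem _ _ (hg j hj))
    · exact add_mem (Submodule.smul_mem _ _ (hg i hi)) (Submodule.smul_mem _ _ (hg j hj))
    · exact hg k hk
  · have hg : ∀ l ∈ S, rotatePair 𝕜 g i j θ l ∈
        Submodule.span 𝕜 (rotatePair 𝕜 g i j θ '' S) := fun l hl =>
      Submodule.subset_span ⟨l, hl, rfl⟩
    by_cases hki : k = i
    · subst hki
      rw [left_eq_rotatePair (𝕜 := 𝕜) g hij θ]
      exact add_mem (Submodule.smul_mem _ _ (hg _ hi)) (Submodule.smul_mem _ _ (hg j hj))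
    by_cases hkj : k = j
    · subst hkj
      rw [right_eq_rotatePair (𝕜 := 𝕜) g hij θ]
      exact add_mem (Submodule.smul_mem _ _ (hg i hi)) (Submodule.smul_mem _ _ (hg _ hj))
    · rw [← rotatePair_of_ne (𝕜 := 𝕜) g hki hkj θ]
      exact hg k hk

end Rotation

/-! ### The quadratic form of a partially defined operator -/

/-- The real quadratic form `v ↦ re ⟪E v, v⟫` on the domain of `E`. -/
noncomputable def quadForm (E : H →ₗ.[𝕜] H) (v : E.domain) : ℝ :=
  RCLike.re ⟪E v, (v : H)⟫_𝕜

theorem quadForm_combination (E : H →ₗ.[𝕜] H) (v w : E.domain) (x y : ℝ) :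
    quadForm E ((x : 𝕜) • v + (y : 𝕜) • w) = x ^ 2 * quadForm E v + y ^ 2 * quadForm E w +
      x * y * (RCLike.re ⟪E v, (w : H)⟫_𝕜 + RCLike.re ⟪E w, (v : H)⟫_𝕜) := by
  simp only [quadForm, LinearPMap.map_add, LinearPMap.map_smul, Submodule.coe_add,
    Submodule.coe_smul, inner_add_left, inner_add_right, inner_smul_left, inner_smul_right,
    RCLike.conj_ofReal, map_add, RCLike.re_ofReal_mul]
  ring

theorem quadForm_rotatePair_right (E : H →ₗ.[𝕜] H) (g : ℕ → E.domain) {i j : ℕ} (hij : i ≠ j)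
    (θ : ℝ) : quadForm E (rotatePair 𝕜 g i j θ j) =
      quadForm E (g i) + quadForm E (g j) - quadForm E (rotatePair 𝕜 g i j θ i) := by
  rw [rotatePair_left, rotatePair_right g hij, quadForm_combination, quadForm_combination]
  linear_combination (quadForm E (g i) + quadForm E (g j)) * Real.sin_sq_add_cos_sq θ

/-- Intermediate value theorem along the rotation from angle `0` to angle `θ₀`. -/
theorem exists_rotatePair_quadForm (E : H →ₗ.[𝕜] H) (g : ℕ → E.domain) (i j : ℕ) {θ₀ c : ℝ}
    (h₀ : 0 ≤ θ₀) (hc : quadForm E (g i) ≤ c)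
    (hc' : c ≤ quadForm E (rotatePair 𝕜 g i j θ₀ i)) :
    ∃ θ ∈ Set.Icc 0 θ₀, quadForm E (rotatePair 𝕜 g i j θ i) = c := by
  simp only [rotatePair_left, quadForm_combination] at hc' ⊢
  refine intermediate_value_Icc h₀ (Continuous.continuousOn (by fun_prop)) ⟨?_, hc'⟩
  simpa using hc

/-- Any amount between `0` and `q (g j) - q (g i)` can be moved from `g j` to `g i`. -/
theorem exists_rotatePair_transfer (E : H →ₗ.[𝕜] H) (g : ℕ → E.domain) (i j : ℕ) {c : ℝ}
    (hc : quadForm E (g i) ≤ c) (hc' : c ≤ quadForm E (g j)) :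
    ∃ θ, quadForm E (rotatePair 𝕜 g i j θ i) = c := by
  obtain ⟨θ, -, hθ⟩ := exists_rotatePair_quadForm E g i j (θ₀ := Real.pi / 2)
    (by positivity) hc (by simpa [rotatePair_left] using hc')
  exact ⟨θ, hθ⟩

/-- For a symmetric operator, a bounded amount can be moved to `g i` by an angle of at most `π / 6`
if `q (g j)` is large: the mixed term of the quadratic form is at most `2 * ‖E (g i)‖`. -/
theorem exists_rotatePair_small_angle (E : H →ₗ.[𝕜] H)
    (hsymm : ∀ f g : E.domain, ⟪E f, (g : H)⟫_𝕜 = ⟪(f : H), E g⟫_𝕜)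
    (g : ℕ → E.domain) (i j : ℕ) {c : ℝ} (hj : ‖g j‖ = 1) (hc : quadForm E (g i) ≤ c)
    (hlarge : 4 * c - 3 * quadForm E (g i) + 4 * ‖E (g i)‖ ≤ quadForm E (g j)) :
    ∃ θ, |Real.sin θ| ≤ 1 / 2 ∧ quadForm E (rotatePair 𝕜 g i j θ i) = c := by
  have hpi := Real.pi_pos
  have hbound : |RCLike.re ⟪E (g i), (g j : H)⟫_𝕜| ≤ ‖E (g i)‖ := by
    have h := (RCLike.abs_re_le_norm _).trans (norm_inner_le_norm (𝕜 := 𝕜) (E (g i)) (g j : H))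
    rwa [show ‖(g j : H)‖ = 1 from hj, mul_one] at h
  have hcross : RCLike.re ⟪E (g j), (g i : H)⟫_𝕜 = RCLike.re ⟪E (g i), (g j : H)⟫_𝕜 := by
    rw [hsymm, ← inner_re_symm]
  obtain ⟨θ, ⟨hθ0, hθ1⟩, hθ⟩ := exists_rotatePair_quadForm E g i j (θ₀ := Real.pi / 6)
    (c := c) (by positivity) hc (by
      rw [rotatePair_left, quadForm_combination, hcross, Real.cos_pi_div_six, Real.sin_pi_div_six]
      have h3 : (√3 : ℝ) ^ 2 = 3 := Real.sq_sqrt (by norm_num)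
      have h3' : (√3 : ℝ) ≤ 2 := by nlinarith [Real.sqrt_nonneg 3]
      have hle : -(2 * ‖E (g i)‖) ≤ √3 * RCLike.re ⟪E (g i), (g j : H)⟫_𝕜 := by
        nlinarith [neg_abs_le (RCLike.re ⟪E (g i), (g j : H)⟫_𝕜), Real.sqrt_nonneg 3,
          norm_nonneg (E (g i))]
      rw [div_pow, h3]
      linarith)
  refine ⟨θ, ?_, hθ⟩
  rw [abs_of_nonneg (Real.sin_nonneg_of_nonneg_of_le_pi hθ0 (by linarith)),
    ← Real.sin_pi_div_six]
  exact Real.sin_le_sin_of_le_of_le_pi_div_two (by linarith) (by linarith) hθ1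

/-! ### Deficits -/

/-- The sum of `d i - q (g i)` over `s ≤ i < n`. -/
noncomputable def deficit (E : H →ₗ.[𝕜] H) (d : ℕ → ℝ) (g : ℕ → E.domain) (s n : ℕ) : ℝ :=
  ∑ i ∈ Ico s n, (d i - quadForm E (g i))

theorem deficit_add (E : H →ₗ.[𝕜] H) (d : ℕ → ℝ) (g : ℕ → E.domain) {s m n : ℕ} (hsm : s ≤ m)
    (hmn : m ≤ n) : deficit E d g s m + deficit E d g m n = deficit E d g s n :=
  sum_Ico_consecutive _ hsm hmn

theorem deficit_succ_self (E : H →ₗ.[𝕜] H) (d : ℕ → ℝ) (g : ℕ → E.domain) (s : ℕ) :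
    deficit E d g s (s + 1) = d s - quadForm E (g s) := by
  simp [deficit]

theorem deficit_congr (E : H →ₗ.[𝕜] H) (d : ℕ → ℝ) {g g' : ℕ → E.domain} {s n : ℕ}
    (h : ∀ i, s ≤ i → i < n → g' i = g i) : deficit E d g' s n = deficit E d g s n :=
  sum_congr rfl fun i hi => by rw [h i (mem_Ico.1 hi).1 (mem_Ico.1 hi).2]

/-- Moving an amount from `g j` to `g s` lowers the deficits that involve `s` but not `j`. -/
theorem deficit_rotatePair_of_le (E : H →ₗ.[𝕜] H) (d : ℕ → ℝ) (g : ℕ → E.domain) {s j n : ℕ}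
    (θ : ℝ) (hsn : s < n) (hnj : n ≤ j) :
    deficit E d (rotatePair 𝕜 g s j θ) s n =
      deficit E d g s n - (quadForm E (rotatePair 𝕜 g s j θ s) - quadForm E (g s)) := by
  rw [← deficit_add E d _ s.le_succ hsn, ← deficit_add E d g s.le_succ hsn,
    deficit_succ_self, deficit_succ_self, deficit_congr E d (g := g)
      fun i h1 h2 => rotatePair_of_ne g (by omega) (by omega) θ]
  ring

/-- A rotation of `g s` and `g j` does not change the deficits that involve both. -/
theorem deficit_rotatePair_of_lt (E : H →ₗ.[𝕜] H) (d : ℕ → ℝ) (g : ℕ → E.domain) {s j n : ℕ}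
    (θ : ℝ) (hsj : s < j) (hjn : j < n) :
    deficit E d (rotatePair 𝕜 g s j θ) s n = deficit E d g s n := by
  rw [← deficit_add E d _ hsj.le hjn.le, ← deficit_add E d _ j.le_succ hjn,
    ← deficit_add E d g hsj.le hjn.le, ← deficit_add E d g j.le_succ hjn,
    deficit_rotatePair_of_le E d g θ hsj le_rfl, deficit_succ_self, deficit_succ_self,
    quadForm_rotatePair_right E g hsj.ne,
    deficit_congr E d (g := g) fun i h1 h2 => rotatePair_of_ne g (by omega) (by omega) θ]
  ring

/-! ### Prescribing the diagonal on a finite block -/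

/-- A finite Schur–Horn theorem: a block on which the deficits are nonnegative, with total deficit
zero, can be rotated so as to have the diagonal `d`. The terms of `g` need not be ordered by `q`. -/
theorem exists_rotation_block (E : H →ₗ.[𝕜] H) {d : ℕ → ℝ} (hd : Monotone d) {s m : ℕ}
    (hsm : s ≤ m) (g : ℕ → E.domain) (hg : Orthonormal 𝕜 g)
    (hnonneg : ∀ n, s ≤ n → n ≤ m → 0 ≤ deficit E d g s n) (hzero : deficit E d g s m = 0) :
    ∃ g' : ℕ → E.domain, Orthonormal 𝕜 g' ∧ (∀ i, i < s ∨ m ≤ i → g' i = g i) ∧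
      (∀ i, s ≤ i → i < m → quadForm E (g' i) = d i) ∧
      Submodule.span 𝕜 (g' '' Set.Ico s m) = Submodule.span 𝕜 (g '' Set.Ico s m) := by
  induction hsm using Nat.decreasingInduction generalizing g with
  | self => exact ⟨g, hg, fun _ _ => rfl, fun i h1 h2 => absurd h1 (by omega), rfl⟩
  | of_succ s hsm ih =>
    -- It suffices to correct the first term of the block.
    suffices h : ∃ g₁ : ℕ → E.domain, Orthonormal 𝕜 g₁ ∧ (∀ i, i < s ∨ m ≤ i → g₁ i = g i) ∧
        quadForm E (g₁ s) = d s ∧ (∀ n, s < n → n ≤ m → 0 ≤ deficit E d g₁ s n) ∧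
        deficit E d g₁ s m = 0 ∧
        Submodule.span 𝕜 (g₁ '' Set.Ico s m) = Submodule.span 𝕜 (g '' Set.Ico s m) by
      obtain ⟨g₁, hg₁, hoff, hs, hn₁, hz₁, hspan⟩ := h
      have htail : ∀ n, s < n → deficit E d g₁ (s + 1) n = deficit E d g₁ s n := fun n hn => by
        rw [← deficit_add E d g₁ s.le_succ hn, deficit_succ_self, hs]; ring
      obtain ⟨g', hg', hoff', hdiag, hspan'⟩ := ih g₁ hg₁
        (fun n h1 h2 => by rw [htail n h1]; exact hn₁ n h1 h2) (by rw [htail m hsm]; exact hz₁)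
      have hs' : g' s = g₁ s := hoff' s (by omega)
      refine ⟨g', hg', fun i hi => ?_, fun i h1 h2 => ?_, ?_⟩
      · rw [hoff' i (by omega), hoff i hi]
      · rcases h1.eq_or_lt with rfl | h1
        · rw [hs', hs]
        · exact hdiag i h1 h2
      · have hIco : Set.Ico s m = insert s (Set.Ico (s + 1) m) := by
          ext x; simp only [Set.mem_Ico, Set.mem_insert_iff]; omega
        rw [← hspan, hIco, Set.image_insert_eq, Set.image_insert_eq, Submodule.span_insert,
          Submodule.span_insert, hs', hspan']
    have hfirst : quadForm E (g s) ≤ d s := by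
      have := hnonneg (s + 1) (by omega) hsm
      rw [deficit_succ_self] at this; linarith
    have hex : ∃ j, s ≤ j ∧ j < m ∧ d s ≤ quadForm E (g j) := by
      by_contra! hcon
      have : 0 < deficit E d g s m := by
        refine sum_pos (fun i hi => ?_) ⟨s, by simpa using hsm⟩
        rw [mem_Ico] at hi
        linarith [hcon i hi.1 hi.2, hd hi.1]
      linarith
    classical
    obtain ⟨hsj, hjm, hj⟩ := Nat.find_spec hex
    have hmin : ∀ i, s ≤ i → i < Nat.find hex → quadForm E (g i) < d s := fun i h1 h2 => by
      by_contra! hcon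
      exact Nat.find_min hex h2 ⟨h1, by omega, hcon⟩
    generalize Nat.find hex = j at hsj hjm hj hmin
    rcases hsj.eq_or_lt with rfl | hsj
    · exact ⟨g, hg, fun _ _ => rfl, le_antisymm hfirst hj,
        fun n h1 h2 => hnonneg n h1.le h2, hzero, rfl⟩
    obtain ⟨θ, hθ⟩ := exists_rotatePair_transfer E g s j hfirst hj
    refine ⟨rotatePair 𝕜 g s j θ, hg.rotatePair hsj.ne θ,
      fun i hi => rotatePair_of_ne g (by omega) (by omega) θ, hθ, fun n h1 h2 => ?_, ?_,
      span_image_rotatePair g hsj.ne θ ⟨le_rfl, hsm⟩ ⟨hsj.le, hjm⟩⟩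
    · rcases le_or_gt n j with hnj | hnj
      · -- Between `s` and `j` the values of `q` are below `d s`, hence below `d`.
        rw [deficit_rotatePair_of_le E d g θ h1 hnj, hθ, ← deficit_succ_self,
          ← deficit_add E d g s.le_succ h1, add_sub_cancel_left]
        refine sum_nonneg fun i hi => ?_
        rw [mem_Ico] at hi
        linarith [hmin i (by omega) (by omega), hd (show s ≤ i by omega)]
      · rw [deficit_rotatePair_of_lt E d g θ hsj hnj]
        exact hnonneg n h1.le h2
    · rw [deficit_rotatePair_of_lt E d g θ hsj hjm, hzero]

/-! ### Stages of the construction -/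

/-- A stage of the construction: the terms of `g` before `s` have the prescribed diagonal, and the
deficits from `s` on are nonnegative. -/
structure IsStage (E : H →ₗ.[𝕜] H) (d : ℕ → ℝ) (f g : ℕ → E.domain) (s : ℕ) : Prop where
  orthonormal : Orthonormal 𝕜 g
  mem_span : ∀ i, g i ∈ Submodule.span 𝕜 (Set.range f)
  diag : ∀ i < s, quadForm E (g i) = d i
  deficit_nonneg : ∀ n, s ≤ n → 0 ≤ deficit E d g s n
  tendsto : Tendsto (fun i => quadForm E (g i)) atTop atTop

/-- The stage `(g', s')` refines `(g, s)`: it keeps the finished terms, finishes at least one more,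
and each newly finished term of `g` lies in the span of the finished terms of `g'` up to at most
one half of a term of `g'`. A term of `g` that is not yet finished lies in that span up to a
contractive multiple of the corresponding term of `g'`. -/
structure Refines {V : Type*} [NormedAddCommGroup V] [InnerProductSpace 𝕜 V]
    (g : ℕ → V) (s : ℕ) (g' : ℕ → V) (s' : ℕ) : Prop where
  lt : s < s'
  eq_of_lt : ∀ i < s, g' i = g i
  finished : ∀ i < s', ∃ (β : 𝕜) (j : ℕ), ‖β‖ ≤ 1 / 2 ∧
    g i - β • g' j ∈ Submodule.span 𝕜 (g' '' Set.Iio s')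
  unfinished : ∀ i, s' ≤ i → ∃ γ : 𝕜, ‖γ‖ ≤ 1 ∧
    g i - γ • g' i ∈ Submodule.span 𝕜 (g' '' Set.Iio s')

theorem IsStage.exists_refines {E : H →ₗ.[𝕜] H}
    (hsymm : ∀ f g : E.domain, ⟪E f, (g : H)⟫_𝕜 = ⟪(f : H), E g⟫_𝕜) {d : ℕ → ℝ}
    (hd : Monotone d) {f g : ℕ → E.domain} {s : ℕ} (h : IsStage E d f g s) :
    ∃ (g' : ℕ → E.domain) (s' : ℕ), IsStage E d f g' s' ∧ Refines (𝕜 := 𝕜) g s g' s' := by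
  obtain ⟨M, hsM, hM⟩ : ∃ M, s < M ∧
      4 * d s - 3 * quadForm E (g s) + 4 * ‖E (g s)‖ ≤ quadForm E (g M) :=
    ((eventually_gt_atTop s).and (h.tendsto.eventually_ge_atTop _)).exists
  obtain ⟨m, hm, hmin⟩ := exists_min_image (Ioc s M) (fun n => deficit E d g s n)
    ⟨M, by simpa using hsM⟩
  obtain ⟨hsm, hmM⟩ := mem_Ioc.1 hm
  set t := deficit E d g s m with ht
  have ht0 : 0 ≤ t := h.deficit_nonneg m hsm.le
  have ht1 : t ≤ d s - quadForm E (g s) := by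
    rw [← deficit_succ_self]
    exact hmin (s + 1) (mem_Ioc.2 ⟨by omega, by omega⟩)
  obtain ⟨θ, hsin, hθ⟩ := exists_rotatePair_small_angle E hsymm g s M
    (c := quadForm E (g s) + t) (h.orthonormal.norm_eq_one M) (by linarith) (by linarith)
  set g₁ := rotatePair 𝕜 g s M θ with hg₁
  have hdef : ∀ n, s < n → n ≤ M → deficit E d g₁ s n = deficit E d g s n - t := fun n h1 h2 => by
    rw [hg₁, deficit_rotatePair_of_le E d g θ h1 h2, hθ, add_sub_cancel_left]
  have hdef0 : deficit E d g₁ s m = 0 := by rw [hdef m hsm hmM, ht, sub_self]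
  have hnonneg : ∀ n, s ≤ n → 0 ≤ deficit E d g₁ s n := fun n hn => by
    rcases hn.eq_or_lt with rfl | hn
    · simp [deficit]
    rcases le_or_gt n M with hnM | hnM
    · rw [hdef n hn hnM, sub_nonneg]
      exact hmin n (mem_Ioc.2 ⟨hn, hnM⟩)
    · rw [hg₁, deficit_rotatePair_of_lt E d g θ hsM hnM]
      exact h.deficit_nonneg n hn.le
  obtain ⟨g', hg', hoff, hdiag, hspan⟩ := exists_rotation_block E hd hsm.le g₁
    (h.orthonormal.rotatePair hsM.ne θ) (fun n h1 _ => hnonneg n h1) hdef0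
  have hg₁mem : ∀ i, g₁ i ∈ Submodule.span 𝕜 (Set.range f) := fun i => by
    have hr : Submodule.span 𝕜 (g₁ '' Set.univ) ≤ Submodule.span 𝕜 (Set.range f) := by
      rw [hg₁, span_image_rotatePair g hsM.ne θ (Set.mem_univ s) (Set.mem_univ M),
        Submodule.span_le]
      rintro _ ⟨k, -, rfl⟩
      exact h.mem_span k
    exact hr (Submodule.subset_span ⟨i, Set.mem_univ i, rfl⟩)
  have hold : ∀ i < s, g' i = g i := fun i hi => by
    rw [hoff i (Or.inl hi), hg₁, rotatePair_of_ne g (by omega) (by omega)]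
  have hblock : ∀ i, s ≤ i → i < m → g₁ i ∈ Submodule.span 𝕜 (g' '' Set.Iio m) :=
    fun i h1 h2 => by
      have hi : g₁ i ∈ Submodule.span 𝕜 (g' '' Set.Ico s m) := by
        rw [hspan]; exact Submodule.subset_span ⟨i, ⟨h1, h2⟩, rfl⟩
      exact Submodule.span_mono (Set.image_mono fun x hx => hx.2) hi
  refine ⟨g', m, ⟨hg', fun i => ?_, fun i hi => ?_, fun n hn => ?_, ?_⟩,
    ⟨hsm, hold, fun i hi => ?_, fun i hi => ?_⟩⟩
  · by_cases hi : s ≤ i ∧ i < m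
    · have hmem : g' i ∈ Submodule.span 𝕜 (g₁ '' Set.Ico s m) := by
        rw [← hspan]; exact Submodule.subset_span ⟨i, hi, rfl⟩
      refine Submodule.span_le.2 ?_ hmem
      rintro _ ⟨k, -, rfl⟩
      exact hg₁mem k
    · rw [hoff i (by omega)]
      exact hg₁mem i
  · rcases lt_or_ge i s with his | his
    · rw [hold i his, h.diag i his]
    · exact hdiag i his hi
  · rw [deficit_congr E d (g := g₁) fun i h1 _ => hoff i (Or.inr h1)]
    have := deficit_add E d g₁ hsm.le hn
    rw [hdef0, zero_add] at this
    rw [this]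
    exact hnonneg n (hsm.le.trans hn)
  · refine h.tendsto.congr' ?_
    filter_upwards [eventually_gt_atTop M] with i hi
    rw [hoff i (by omega), hg₁, rotatePair_of_ne g (by omega) (by omega)]
  · rcases lt_trichotomy i s with his | rfl | his
    · refine ⟨0, 0, by norm_num, ?_⟩
      rw [zero_smul, sub_zero, ← hold i his]
      exact Submodule.subset_span ⟨i, hi, rfl⟩
    · refine ⟨((-Real.sin θ : ℝ) : 𝕜), M, by rw [RCLike.norm_ofReal, abs_neg]; exact hsin, ?_⟩
      rw [hoff M (Or.inr hmM)]
      nth_rewrite 1 [left_eq_rotatePair (𝕜 := 𝕜) g hsM.ne θ]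
      rw [← hg₁, add_sub_cancel_right]
      exact Submodule.smul_mem _ _ (hblock i le_rfl hi)
    · refine ⟨0, 0, by norm_num, ?_⟩
      rw [zero_smul, sub_zero, ← rotatePair_of_ne (𝕜 := 𝕜) g (i := s) (j := M) (by omega)
        (by omega) θ]
      exact hblock i his.le hi
  · by_cases hiM : i = M
    · subst hiM
      refine ⟨((Real.cos θ : ℝ) : 𝕜),
        by rw [RCLike.norm_ofReal]; exact Real.abs_cos_le_one θ, ?_⟩
      rw [hoff i (Or.inr hi)]
      nth_rewrite 1 [right_eq_rotatePair (𝕜 := 𝕜) g hsM.ne θ]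
      rw [← hg₁, add_sub_cancel_right]
      exact Submodule.smul_mem _ _ (hblock s le_rfl hsm)
    · refine ⟨1, by simp, ?_⟩
      rw [one_smul, hoff i (Or.inr hi), hg₁, rotatePair_of_ne g (by omega) hiM, sub_self]
      exact zero_mem _

/-! ### The limit of a refining sequence of stages -/

section Limit

variable {V : Type*} [NormedAddCommGroup V] [InnerProductSpace 𝕜 V]

theorem Refines.le_index {G : ℕ → ℕ → V} {s : ℕ → ℕ}
    (hR : ∀ k, Refines (𝕜 := 𝕜) (G k) (s k) (G (k + 1)) (s (k + 1))) (k : ℕ) : k ≤ s k :=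
  (strictMono_nat_of_lt_succ fun k => (hR k).lt).le_apply

/-- Finished terms no longer change. -/
theorem Refines.stable {G : ℕ → ℕ → V} {s : ℕ → ℕ}
    (hR : ∀ k, Refines (𝕜 := 𝕜) (G k) (s k) (G (k + 1)) (s (k + 1))) {i k : ℕ} (hi : i < s k) :
    G k i = G (i + 1) i := by
  have hmono : StrictMono s := strictMono_nat_of_lt_succ fun k => (hR k).lt
  have key : ∀ k l, k ≤ l → i < s k → G l i = G k i := fun k l hkl hik => by
    induction l, hkl using Nat.le_induction with
    | base => rfl
    | succ l hkl ih => rw [(hR l).eq_of_lt i (hik.trans_le (hmono.monotone hkl)), ih]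
  rw [← key k _ (le_max_left k (i + 1)) hi,
    ← key (i + 1) _ (le_max_right k (i + 1)) (Refines.le_index hR (i + 1))]

/-- Every term of every stage is within `(1 / 2) ^ r` of the span of the finished terms: until it is
finished its error does not grow from one stage to the next, and then it is halved. -/
theorem Refines.exists_norm_sub_le {G : ℕ → ℕ → V} {s : ℕ → ℕ}
    (hR : ∀ k, Refines (𝕜 := 𝕜) (G k) (s k) (G (k + 1)) (s (k + 1)))
    (hnorm : ∀ k i, ‖G k i‖ = 1) (r k i : ℕ) :
    ∃ u ∈ Submodule.span 𝕜 (Set.range fun i => G (i + 1) i), ‖G k i - u‖ ≤ (1 / 2) ^ r := by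
  have hsub : ∀ k, Submodule.span 𝕜 (G k '' Set.Iio (s k)) ≤
      Submodule.span 𝕜 (Set.range fun i => G (i + 1) i) := fun k => by
    refine Submodule.span_mono ?_
    rintro _ ⟨i, hi, rfl⟩
    exact ⟨i, (Refines.stable hR hi).symm⟩
  -- Errors propagate backwards along `x - β • y ∈ span`.
  have hprop : ∀ {x y : V} {β : 𝕜} {a b : ℝ}, ‖β‖ ≤ a → 0 ≤ b →
      x - β • y ∈ Submodule.span 𝕜 (Set.range fun i => G (i + 1) i) →
      (∃ u ∈ Submodule.span 𝕜 (Set.range fun i => G (i + 1) i), ‖y - u‖ ≤ b) →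
      ∃ u ∈ Submodule.span 𝕜 (Set.range fun i => G (i + 1) i), ‖x - u‖ ≤ a * b := by
    rintro x y β a b hβ hb hx ⟨u, hu, hyu⟩
    refine ⟨x - β • y + β • u, add_mem hx (Submodule.smul_mem _ _ hu), ?_⟩
    rw [show x - (x - β • y + β • u) = β • (y - u) by module, norm_smul]
    exact mul_le_mul hβ hyu (norm_nonneg _) ((norm_nonneg _).trans hβ)
  induction r generalizing k i with
  | zero => exact ⟨0, zero_mem _, by simp [hnorm]⟩
  | succ r ih =>
    have hpos : (0 : ℝ) ≤ (1 / 2) ^ r := by positivity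
    have key : ∀ n k, i < s (k + n + 1) →
        ∃ u ∈ Submodule.span 𝕜 (Set.range fun i => G (i + 1) i),
          ‖G k i - u‖ ≤ (1 / 2) ^ (r + 1) := fun n => by
      induction n with
      | zero =>
        intro k hi
        obtain ⟨β, j, hβ, hmem⟩ := (hR k).finished i hi
        rw [pow_succ']
        exact hprop hβ hpos (hsub _ hmem) (ih (k + 1) j)
      | succ n ihn =>
        intro k hi
        rcases lt_or_ge i (s (k + 1)) with hik | hik
        · obtain ⟨β, j, hβ, hmem⟩ := (hR k).finished i hik
          rw [pow_succ']
          exact hprop hβ hpos (hsub _ hmem) (ih (k + 1) j)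
        · obtain ⟨γ, hγ, hmem⟩ := (hR k).unfinished i hik
          rw [← one_mul ((1 / 2 : ℝ) ^ (r + 1))]
          refine hprop hγ (by positivity) (hsub _ hmem) (ihn (k + 1) ?_)
          rwa [show k + 1 + n + 1 = k + (n + 1) + 1 by ring]
    exact key i k (lt_of_lt_of_le (by omega) (Refines.le_index hR (k + i + 1)))

end Limit

end Construction

/-! ### Assembling the orthonormal sequence -/

theorem theorem2p1 {𝕜 : Type*} [RCLike 𝕜] {H : Type*} [NormedAddCommGroup H]
    [InnerProductSpace 𝕜 H] [CompleteSpace H]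
    (E : H →ₗ.[𝕜] H) (hdense : Dense (E.domain : Set H))
    (hsymm : ∀ f g : E.domain, ⟪E f, (g : H)⟫_𝕜 = ⟪(f : H), E g⟫_𝕜)
    (d lam : ℕ → ℝ) (hd : Monotone d) (hlam : Monotone lam)
    (hd_unbdd : ¬ BddAbove (Set.range d)) (hlam_unbdd : ¬ BddAbove (Set.range lam))
    (hmaj : ∀ n : ℕ, ∑ i ∈ Finset.range n, lam i ≤ ∑ i ∈ Finset.range n, d i)
    (f : ℕ → E.domain) (hf : Orthonormal 𝕜 (fun i => (f i : H)))
    (hfdiag : ∀ i, ⟪E (f i), (f i : H)⟫_𝕜 = (lam i : 𝕜)) :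
    ∃ e : ℕ → E.domain,
      Orthonormal 𝕜 (fun i => (e i : H)) ∧
      (∀ i, (e i : H) ∈ Submodule.span 𝕜 (Set.range fun j => (f j : H))) ∧
      (Submodule.span 𝕜 (Set.range fun j => (e j : H))).topologicalClosure =
        (Submodule.span 𝕜 (Set.range fun j => (f j : H))).topologicalClosure ∧
      ∀ i, ⟪E (e i), (e i : H)⟫_𝕜 = (d i : 𝕜) := by
  have hquad : ∀ i, quadForm E (f i) = lam i := fun i => by simp [quadForm, hfdiag]
  have hf' : Orthonormal 𝕜 f := ⟨fun i => hf.1 i, fun i j hij => hf.2 hij⟩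
  have h₀ : IsStage E d f f 0 := by
    refine ⟨hf', fun i => Submodule.subset_span ⟨i, rfl⟩, fun i hi => absurd hi (by omega),
      fun n _ => ?_, ?_⟩
    · simp only [deficit, hquad, Finset.sum_sub_distrib, sub_nonneg, ← Finset.range_eq_Ico]
      exact hmaj n
    · simp only [hquad]
      exact Filter.tendsto_atTop_atTop_of_monotone' hlam hlam_unbdd
  have hnext : ∀ p : {p : (ℕ → E.domain) × ℕ // IsStage E d f p.1 p.2},
      ∃ p' : {p : (ℕ → E.domain) × ℕ // IsStage E d f p.1 p.2},
        Refines (𝕜 := 𝕜) p.1.1 p.1.2 p'.1.1 p'.1.2 := fun p => by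
    obtain ⟨g', s', hstage, hR⟩ := p.2.exists_refines hsymm hd
    exact ⟨⟨(g', s'), hstage⟩, hR⟩
  choose next hnext using hnext
  set P : ℕ → {p : (ℕ → E.domain) × ℕ // IsStage E d f p.1 p.2} :=
    fun k => next^[k] ⟨(f, 0), h₀⟩ with hP
  set G : ℕ → ℕ → E.domain := fun k => (P k).1.1 with hG
  set s : ℕ → ℕ := fun k => (P k).1.2 with hs
  have hR : ∀ k, Refines (𝕜 := 𝕜) (G k) (s k) (G (k + 1)) (s (k + 1)) := fun k => by
    simp only [hG, hs, hP, Function.iterate_succ_apply']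
    exact hnext _
  have hstage : ∀ k, IsStage E d f (G k) (s k) := fun k => (P k).2
  have hlt : ∀ {i k}, i < k → i < s k := fun h => h.trans_le (Refines.le_index hR _)
  have hmem : ∀ i, (G (i + 1) i : H) ∈ Submodule.span 𝕜 (Set.range fun j => (f j : H)) :=
    fun i => by
      have := Submodule.mem_map_of_mem (f := E.domain.subtype) ((hstage (i + 1)).mem_span i)
      rwa [Submodule.map_span, ← Set.range_comp] at this
  refine ⟨fun i => G (i + 1) i, ⟨fun i => (hstage (i + 1)).orthonormal.1 i, fun i j hij => ?_⟩,
    hmem, le_antisymm ?_ ?_, fun i => ?_⟩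
  · have hi := Refines.stable hR (hlt (show i < max i j + 1 by omega))
    have hj := Refines.stable hR (hlt (show j < max i j + 1 by omega))
    change ⟪G (i + 1) i, G (j + 1) j⟫_𝕜 = 0
    rw [← hi, ← hj]
    exact (hstage (max i j + 1)).orthonormal.2 hij
  · refine Submodule.topologicalClosure_mono (Submodule.span_le.2 ?_)
    rintro _ ⟨i, rfl⟩
    exact hmem i
  · refine Submodule.topologicalClosure_minimal _ (Submodule.span_le.2 ?_)
      (Submodule.isClosed_topologicalClosure _)
    rintro _ ⟨i, rfl⟩
    refine Metric.mem_closure_iff.2 fun ε hε => ?_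
    obtain ⟨r, hr⟩ := exists_pow_lt_of_lt_one hε (show (1 / 2 : ℝ) < 1 by norm_num)
    obtain ⟨u, hu, hle⟩ := Refines.exists_norm_sub_le hR
      (fun k i => (hstage k).orthonormal.1 i) r 0 i
    refine ⟨u, ?_, ?_⟩
    · have := Submodule.mem_map_of_mem (f := E.domain.subtype) hu
      rwa [Submodule.map_span, ← Set.range_comp] at this
    · rw [dist_eq_norm]
      exact lt_of_le_of_lt hle hr
  · -- By symmetry `⟪E e, e⟫` is real, so it is determined by `quadForm`.
    have hreal := RCLike.conj_eq_iff_re.1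
      ((inner_conj_symm (G (i + 1) i : H) (E (G (i + 1) i))).trans (hsymm _ _).symm)
    rw [← hreal]
    exact congrArg _ ((hstage (i + 1)).diag i (hlt i.lt_succ_self))
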